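/- Let $q=e^{2\pi i z}$ for $z$ in the complex upper half-plane, and let $E_2 = 1-24\sum_{n\ge1}\sigma_1(n)q^n$, $E_4=1+240\sum_{n\ge1}\sigma_3(n)q^n$, $E_6=1-504\sum_{n\ge1}\sigma_5(n)q^n$, where $\sigma_a(n)=\sum_{d\mid n}d^a$. For integers $w,s\ge 0$ let $\mathcal{QM}_w^{s}$ be the space of quasimodular forms of weight $w$, depth at most $s$ and level $\mathrm{SL}_2(\mathbb Z)$, that is, the complex span of the functions $E_2^aE_4^bE_6^c$ with integers $a,b,c\ge0$, $2a+4b+6c=w$ and $a\le s$. With $m=\dim_{\mathbb C}\mathcal{QM}_w^{1}$, a normalized extremal quasimodular form of weight $w$ and depth $1$ is a form $f=\sum_{n\ge0}a_nq^n\in\mathcal{QM}_w^{1}\setminus\mathcal{QM}_w^{0}$ such that $a_0=a_1=\cdots=a_{m-2}=0$ and $a_{m-1}=1$. Corollary 4.4 (Kaneko–Koike's conjecture in depth $1$). Let $w\ge6$ be an even integer. There is exactly one normalized extremal quasimodular form $X_{w,1}$ of weight $w$ and depth $1$, and all its Fourier coefficients $a_n$ are nonnegative real numbers; moreover $a_n>0$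 for every $n\ge m-1$. -/

import Mathlib

namespace QuasimodularForm

open UpperHalfPlane

/-- `QM w s` is the space `𝒬ℳ_w^s` of quasimodular forms of level `SL₂(ℤ)`, weight `w` and
depth at most `s`. The ring of quasimodular forms is the polynomial ring `ℂ[E₂, E₄, E₆]` with the
generators in weights `2, 4, 6`, and the depth is the degree in `E₂`, so this space is spanned by
the monomials `E₂ ^ a * E₄ ^ b * E₆ ^ c` of weight `2 a + 4 b + 6 c = w` with `a ≤ s`. -/
noncomputable def QM (w s : ℕ) : Submodule ℂ (ℍ → ℂ) :=
  Submodule.span ℂ {f | ∃ a b c : ℕ, a ≤ s ∧ 2 * a + 4 * b + 6 * c = w ∧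
    f = fun z => EisensteinSeries.E2 z ^ a * ModularForm.E₄ z ^ b * ModularForm.E₆ z ^ c}

/-- The `n`-th Fourier coefficient `a_n` of `f = ∑ a_n q ^ n`, where `q = exp (2 π i z)`. -/
noncomputable def fourierCoeff (f : ℍ → ℂ) (n : ℕ) : ℂ := (qExpansion 1 f).coeff n

/-- An extremal quasimodular form of weight `w` and depth (exactly) `s`: with
`m = dim 𝒬ℳ_w^s`, the first `m` Fourier coefficients satisfy
`a_0 = ⋯ = a_(m-2) = 0` and `a_(m-1) ≠ 0`. -/
structure IsExtremal (w s : ℕ) (f : ℍ → ℂ) : Prop where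
  mem : f ∈ QM w s
  depth : ∀ t < s, f ∉ QM w t
  vanishing : ∀ n : ℕ, n + 1 < Module.finrank ℂ (QM w s) → fourierCoeff f n = 0
  leading : fourierCoeff f (Module.finrank ℂ (QM w s) - 1) ≠ 0

/-- A normalized extremal quasimodular form: its first nonzero Fourier coefficient, which is the
one of index `dim 𝒬ℳ_w^s - 1`, equals `1`. -/
structure IsNormalizedExtremal (w s : ℕ) (f : ℍ → ℂ) : Prop extends IsExtremal w s f where
  normalized : fourierCoeff f (Module.finrank ℂ (QM w s) - 1) = 1

/-- All Fourier coefficients are nonnegative real numbers. -/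
def IsCompletelyPositive (f : ℍ → ℂ) : Prop :=
  ∀ n : ℕ, ∃ r : ℝ, 0 ≤ r ∧ fourierCoeff f n = (r : ℂ)

end QuasimodularForm

/-! ### Periodic holomorphic functions bounded at i∞, and the `q`-expansion of the derivative. -/

namespace QuasimodularForm

open UpperHalfPlane hiding I
open Complex Function
open scoped Manifold MatrixGroups ModularForm Derivative

/-! Write θ = q d/dq and let P_n, Q_n be the components of `extremal n`, of weights 6n and 6n+2.
They start from (1, E₂), and each step cancels the common leading term q^n: P_{n+1} is a multiple of
E₄Q_n − E₆P_n, and Q_{n+1} of E₄²P_n − E₆Q_n. By Ramanujan's formulas for θE₂, θE₄, θE₆, each pair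
solves a first-order linear system (`extremal_system`), which also shows that the chosen scalars
make the next leading coefficients 1 (`hasLeading_extremal`).

Positivity is invisible in the recursion because of its minus signs. Inserted into the system,
however, the recursion recombines into 1728 θP_{n+1} = (n+1)(3θE₄·Q_n − 2θE₆·P_n), and similarly for
Q_{n+1} (`extremal_qDeriv_fst`, `extremal_qDeriv_snd`). As θE₄ and −θE₆ have positive coefficients,
positivity passes from n to n+1 (`posFrom_extremal`).

In weight 2h, powers of E₄ times P_j or Q_j give a form with leading term q^j for every j ≤ h/3.
There are at most h/3 + 1 spanning monomials, so these forms are a basis and the first h/3 + 1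
coefficients determine a form (`finrank_QM_and_injective`). The extremal form is the one with j =
h/3; the Sturm bound keeps it out of depth 0. -/

/-- Holomorphic functions on the upper half plane that are `1`-periodic and bounded at `i∞`. -/
structure IsRegular (f : ℍ → ℂ) : Prop where
  periodic : Periodic (f ∘ ofComplex) (1 : ℝ)
  mdiff : MDiff f
  bounded : IsBoundedAtImInfty f

namespace IsRegular

variable {f g : ℍ → ℂ}

lemma analyticAt (hf : IsRegular f) : AnalyticAt ℂ (cuspFunction 1 f) 0 :=
  analyticAt_cuspFunction_zero one_pos hf.periodic hf.mdiff hf.bounded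

lemma const (c : ℂ) : IsRegular (fun _ ↦ c) where
  periodic := fun _ ↦ rfl
  mdiff := mdifferentiable_const
  bounded := Filter.const_boundedAtFilter _ c

lemma add (hf : IsRegular f) (hg : IsRegular g) : IsRegular (f + g) where
  periodic := hf.periodic.add hg.periodic
  mdiff := hf.mdiff.add hg.mdiff
  bounded := hf.bounded.add hg.bounded

lemma mul (hf : IsRegular f) (hg : IsRegular g) : IsRegular (f * g) where
  periodic := hf.periodic.mul hg.periodic
  mdiff := hf.mdiff.mul hg.mdiff
  bounded := hf.bounded.mul hg.bounded

lemma smul (c : ℂ) (hf : IsRegular f) : IsRegular (c • f) :=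
  (const c).mul hf

lemma sub (hf : IsRegular f) (hg : IsRegular g) : IsRegular (f - g) := by
  have := hf.add (hg.smul (-1))
  rwa [neg_one_smul, ← sub_eq_add_neg] at this

lemma pow (hf : IsRegular f) (n : ℕ) : IsRegular (f ^ n) := by
  induction n with
  | zero => rw [pow_zero]; exact const 1
  | succ n ih => rw [pow_succ]; exact ih.mul hf

lemma qExpansion_pow (hf : IsRegular f) (n : ℕ) :
    qExpansion 1 (f ^ n) = qExpansion 1 f ^ n := by
  induction n with
  | zero => rw [pow_zero, pow_zero]; exact qExpansion_one 1
  | succ n ih => rw [pow_succ, pow_succ, qExpansion_mul (hf.pow n).analyticAt hf.analyticAt, ih]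

lemma of_hasSum {c : ℕ → ℂ} (hf : MDiff f)
    (h : ∀ τ : ℍ, HasSum (fun m ↦ c m • Periodic.qParam 1 τ ^ m) (f τ)) : IsRegular f where
  periodic := by
    intro z
    by_cases hz : 0 < z.im
    · have hz' : 0 < (z + (1 : ℝ)).im := by simpa using hz
      simp only [comp_apply, ofComplex_apply_of_im_pos hz, ofComplex_apply_of_im_pos hz']
      have h1 := h ⟨z, hz⟩
      have h2 := h ⟨z + (1 : ℝ), hz'⟩
      have : Periodic.qParam 1 (z + (1 : ℝ)) = Periodic.qParam 1 z := by
        simp [Periodic.qParam, mul_add, exp_add]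
      simp only [this] at h2
      exact h2.unique h1
    -- Off the upper half plane `ofComplex` is constant, so periodicity is trivial there.
    · have hz' : ¬ 0 < (z + (1 : ℝ)).im := by simpa using hz
      simp only [comp_apply]
      rw [ofComplex_apply_of_im_nonpos (not_lt.mp hz), ofComplex_apply_of_im_nonpos (not_lt.mp hz')]
  mdiff := hf
  bounded := isBoundedAtImInfty_of_hasSum_qExpansion one_pos h

lemma hasSum_deriv (hf : IsRegular f) (τ : ℍ) :
    HasSum (fun m : ℕ ↦ ((m : ℂ) * (qExpansion 1 f).coeff m) • Periodic.qParam 1 τ ^ m)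
      ((D f) τ) := by
  set F := cuspFunction 1 f with hF
  set q := Periodic.qParam 1 (τ : ℂ) with hq
  have hq1 : ‖q‖ < 1 := Periodic.norm_qParam_lt_one one_pos τ.im_pos
  have hFd : DifferentiableOn ℂ F (Metric.ball 0 1) :=
    differentiableOn_cuspFunction_ball one_pos hf.periodic hf.mdiff hf.bounded
  have hqd : HasDerivAt (Periodic.qParam 1) (2 * Real.pi * I * q) (τ : ℂ) := by
    have : HasDerivAt (fun z : ℂ ↦ cexp (2 * Real.pi * I * z / (1 : ℝ)))
        (cexp (2 * Real.pi * I * τ / (1 : ℝ)) * (2 * Real.pi * I * 1 / (1 : ℝ))) (τ : ℂ) :=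
      (((hasDerivAt_id (τ : ℂ)).const_mul (2 * Real.pi * I)).div_const _).cexp
    have hfun : Periodic.qParam 1 = fun z : ℂ ↦ cexp (2 * Real.pi * I * z / (1 : ℝ)) := rfl
    rw [hq, hfun]
    convert! this using 1
    push_cast
    ring
  have hFq : HasDerivAt F (deriv F q) q :=
    (hFd.differentiableAt (Metric.isOpen_ball.mem_nhds (by simpa using hq1))).hasDerivAt
  have hcomp := hFq.comp (τ : ℂ) hqd
  have heq : (f ∘ ofComplex) =ᶠ[nhds (τ : ℂ)] F ∘ Periodic.qParam 1 := by
    filter_upwards [isOpen_upperHalfPlaneSet.mem_nhds τ.im_pos] with z hz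
    have := eq_cuspFunction ⟨z, hz⟩ one_ne_zero hf.periodic
    simp only [comp_apply, ofComplex_apply_of_im_pos hz]
    exact this.symm
  -- Chain rule through q: D becomes q d/dq on the cusp function. The zeroth term then drops out,
  -- and the shifted series is q times the Taylor series of F'.
  have hD : (D f) τ = q * deriv F q := by
    rw [Derivative.normalizedDerivOfComplex, (hcomp.congr_of_eventuallyEq heq).deriv]
    have := two_pi_I_ne_zero
    field_simp
  have hs := hasSum_taylorSeries_on_ball (hFd.deriv Metric.isOpen_ball)
    (by simpa using hq1 : q ∈ Metric.ball (0 : ℂ) 1)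
  rw [hD, ← hasSum_nat_add_iff' 1]
  convert! hs.mul_left q using 1
  · ext m
    rw [← iteratedDeriv_succ', qExpansion_coeff, Nat.factorial_succ]
    have : (m.factorial : ℂ) ≠ 0 := by exact_mod_cast m.factorial_ne_zero
    have : (m : ℂ) + 1 ≠ 0 := by exact_mod_cast m.succ_ne_zero
    simp only [smul_eq_mul, sub_zero]
    push_cast
    field_simp
    ring
  · simp

lemma derivative (hf : IsRegular f) : IsRegular (D f) :=
  of_hasSum (Derivative.normalizedDerivOfComplex_mdifferentiable hf.mdiff) hf.hasSum_deriv

lemma qExpansion_coeff_of_hasSum (hf : IsRegular f) {c : ℕ → ℂ}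
    (h : ∀ τ : ℍ, HasSum (fun m ↦ c m • Periodic.qParam 1 τ ^ m) (f τ)) (m : ℕ) :
    (qExpansion 1 f).coeff m = c m := by
  have h1 := (hasFPowerSeriesOnBall_cuspFunction one_pos hf.analyticAt h).hasFPowerSeriesAt
  have h2 := congrArg (FormalMultilinearSeries.coeff · m)
    (h1.eq_formalMultilinearSeries hf.analyticAt.hasFPowerSeriesAt)
  simp only [FormalMultilinearSeries.coeff_ofScalars] at h2
  rw [h2, qExpansion_coeff, div_eq_inv_mul]

lemma qExpansion_coeff_derivative (hf : IsRegular f) (m : ℕ) :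
    (qExpansion 1 (D f)).coeff m = m * (qExpansion 1 f).coeff m := by
  have h := hf.hasSum_deriv
  exact hf.derivative.qExpansion_coeff_of_hasSum
    (c := fun m : ℕ ↦ (m : ℂ) * (qExpansion 1 f).coeff m) h m

lemma slash_eq_of_mem_range {k : ℤ} (h : ∀ γ : SL(2, ℤ), f ∣[k] γ = f) :
    ∀ γ ∈ 𝒮ℒ, f ∣[k] γ = f := by
  rintro _ ⟨γ, rfl⟩
  have := h γ
  rw [ModularForm.SL_slash] at this
  exact this

lemma isBoundedAt (hf : IsRegular f) {k : ℤ} (h : ∀ γ : SL(2, ℤ), f ∣[k] γ = f)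
    {c : OnePoint ℝ} (hc : IsCusp c 𝒮ℒ) : c.IsBoundedAt f k := by
  rw [OnePoint.isBoundedAt_iff_forall_SL2Z hc]
  intro γ _
  rw [h γ]
  exact hf.bounded

/-- A regular function invariant under the weight `k` action of `SL₂(ℤ)`, as a modular form. -/
noncomputable def toModularForm (hf : IsRegular f) {k : ℤ} (h : ∀ γ : SL(2, ℤ), f ∣[k] γ = f) :
    ModularForm 𝒮ℒ k where
  toFun := f
  slash_action_eq' := slash_eq_of_mem_range h
  holo' := hf.mdiff
  bdd_at_cusps' hc := hf.isBoundedAt h hc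

/-- The Sturm bound in weight less than `12`. -/
lemma eq_zero_of_slash_invariant (hf : IsRegular f) {k : ℕ} (hk : k < 12)
    (h : ∀ γ : SL(2, ℤ), f ∣[(k : ℤ)] γ = f) (h0 : (qExpansion 1 f).coeff 0 = 0) : f = 0 := by
  have : hf.toModularForm h = 0 := by
    apply ModularForm.sturm_bound_levelOne_nat
    rw [Nat.div_eq_of_lt hk, Nat.cast_zero, pos_iff_ne_zero,
      PowerSeries.order_ne_zero_iff_constCoeff_eq_zero,
      ← PowerSeries.coeff_zero_eq_constantCoeff_apply]
    exact h0
  exact congrArg DFunLike.coe this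

end IsRegular

/-! ### Fourier expansions of the Eisenstein series. -/

lemma isRegular_of_modularForm {k : ℤ} (f : ModularForm 𝒮ℒ k) : IsRegular f where
  periodic := SlashInvariantFormClass.periodic_comp_ofComplex f one_mem_strictPeriods_SL
  mdiff := f.holo'
  bounded := ModularFormClass.bdd_at_infty f

lemma hasSum_E₂ (τ : ℍ) : HasSum (fun m : ℕ ↦ (if m = 0 then 1 else
    -24 * (ArithmeticFunction.sigma 1 m : ℂ)) • Periodic.qParam 1 τ ^ m)
    (EisensteinSeries.E2 τ) := by
  simpa only [Periodic.qParam, ofReal_one, div_one] using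
    EisensteinSeries.hasSum_qExpansion_E2 (z := τ)

lemma isRegular_E₂ : IsRegular EisensteinSeries.E2 :=
  .of_hasSum E2_mdifferentiable hasSum_E₂

lemma qExpansion_E₂_coeff (m : ℕ) : (qExpansion 1 EisensteinSeries.E2).coeff m =
    if m = 0 then 1 else -24 * (ArithmeticFunction.sigma 1 m : ℂ) :=
  isRegular_E₂.qExpansion_coeff_of_hasSum (c := fun m ↦ if m = 0 then 1 else
    -24 * (ArithmeticFunction.sigma 1 m : ℂ)) hasSum_E₂ m

lemma isRegular_E₄ : IsRegular ModularForm.E₄ := isRegular_of_modularForm _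

lemma isRegular_E₆ : IsRegular ModularForm.E₆ := isRegular_of_modularForm _

lemma qExpansion_E₄_coeff (m : ℕ) : (qExpansion 1 ModularForm.E₄).coeff m =
    if m = 0 then 1 else 240 * (ArithmeticFunction.sigma 3 m : ℂ) := by
  rw [EisensteinSeries.E_qExpansion_coeff _ ⟨2, rfl⟩, show bernoulli 4 = -1 / 30 by decide +kernel]
  norm_num

lemma qExpansion_E₆_coeff (m : ℕ) : (qExpansion 1 ModularForm.E₆).coeff m =
    if m = 0 then 1 else -504 * (ArithmeticFunction.sigma 5 m : ℂ) := by
  rw [EisensteinSeries.E_qExpansion_coeff _ ⟨3, rfl⟩, show bernoulli 6 = 1 / 42 by decide +kernel]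
  norm_num

lemma E₄_slash (γ : SL(2, ℤ)) : (ModularForm.E₄ : ℍ → ℂ) ∣[(4 : ℤ)] γ = ModularForm.E₄ :=
  ModularForm.E₄.slash_action_eq' _ ⟨γ, rfl⟩

lemma E₆_slash (γ : SL(2, ℤ)) : (ModularForm.E₆ : ℍ → ℂ) ∣[(6 : ℤ)] γ = ModularForm.E₆ :=
  ModularForm.E₆.slash_action_eq' _ ⟨γ, rfl⟩

lemma constantCoeff_E₂ : (qExpansion 1 EisensteinSeries.E2).constantCoeff = 1 := by
  simpa using qExpansion_E₂_coeff 0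

lemma constantCoeff_E₄ : (qExpansion 1 ModularForm.E₄).constantCoeff = 1 := by
  simpa using qExpansion_E₄_coeff 0

lemma constantCoeff_E₆ : (qExpansion 1 ModularForm.E₆).constantCoeff = 1 := by
  simpa using qExpansion_E₆_coeff 0

/-! ### Ramanujan's differential equations. -/

open EisensteinSeries in
/-- The quasimodular combination `D E₂ - E₂² / 12` is invariant of weight `4`. -/
lemma serreDerivative_E₂_slash (γ : SL(2, ℤ)) :
    (D E2 - (12⁻¹ : ℂ) • (E2 * E2)) ∣[(4 : ℤ)] γ = D E2 - (12⁻¹ : ℂ) • (E2 * E2) := by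
  -- With u = c/(cz+d), E₂ transforms to E₂ + αu, and u' = −u². Since α/12 = (2πi)⁻¹, the u² and uE₂
  -- terms produced by D E₂ and by E₂²/12 cancel.
  set α : ℂ := 12 * (2 * Real.pi * I)⁻¹ with hα
  set u : ℍ → ℂ := fun z ↦ γ 1 0 / denom γ z with hu
  have hE : E2 ∣[(2 : ℤ)] γ = E2 + α • u := by
    rw [E2_slash_action]
    ext z
    have := Real.pi_ne_zero
    have h3 := I_sq
    simp only [Pi.sub_apply, Pi.smul_apply, Pi.add_apply, hu, hα, smul_eq_mul, D2, riemannZeta_two]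
    field_simp
    grind
  have hud (z : ℍ) : HasDerivAt (u ∘ ofComplex) (-u z ^ 2) z := by
    have h1 := (hasDerivAt_denom_zpow (γ : GL (Fin 2) ℝ) (-1) z).const_mul (γ 1 0 : ℂ)
    have h2 : u ∘ ofComplex =ᶠ[nhds (z : ℂ)] fun w ↦ (γ 1 0 : ℂ) * denom γ w ^ (-1 : ℤ) := by
      filter_upwards [isOpen_upperHalfPlaneSet.mem_nhds z.im_pos] with w hw
      simp [hu, ofComplex_apply_of_im_pos hw, div_eq_mul_inv]
    convert! h1.congr_of_eventuallyEq h2 using 1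
    have := denom_ne_zero (γ : GL (Fin 2) ℝ) z
    have h3 : (-1 - 1 : ℤ) = -2 := rfl
    simp only [hu, h3, zpow_neg, zpow_ofNat]
    simp
    field_simp
  have hmu : MDiff u := by
    rw [UpperHalfPlane.mdifferentiable_iff]
    exact fun w hw ↦ (hud ⟨w, hw⟩).differentiableAt.differentiableWithinAt
  have hDE : D (E2 ∣[(2 : ℤ)] γ) = D E2 - (α * (2 * Real.pi * I)⁻¹) • u ^ 2 := by
    rw [hE, Derivative.normalizedDerivOfComplex_add _ _ E2_mdifferentiable
      (hmu.const_smul α), Derivative.normalizedDerivOfComplex_smul _ _ hmu]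
    ext z
    have := (hud z).deriv
    simp only [Pi.add_apply, Pi.sub_apply, Pi.smul_apply, Pi.pow_apply, smul_eq_mul,
      Derivative.normalizedDerivOfComplex]
    rw [this]
    ring
  have hslash := Derivative.normalizedDerivOfComplex_SL_slash (k := 2) E2_mdifferentiable (γ := γ)
  have hmul := ModularForm.mul_slash_SL2 2 2 γ E2 E2
  have h22 : (2 + 2 : ℤ) = 4 := rfl
  rw [h22] at hmul hslash
  rw [sub_eq_add_neg, SlashAction.add_slash, ← _root_.neg_smul, ModularForm.SL_smul_slash, hmul,
    eq_add_of_sub_eq hslash.symm, hDE, hE]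
  ext z
  simp only [Pi.add_apply, Pi.sub_apply, Pi.smul_apply, Pi.pow_apply, Pi.mul_apply, smul_eq_mul, hα,
    hu]
  push_cast
  ring

/-- The difference of the two sides is invariant of weight 4 with constant term 0, hence zero by the
Sturm bound. The formulas for E₄ and E₆ follow in the same way from their Serre derivatives, in
weights 6 and 8. -/
lemma derivative_E₂ : D EisensteinSeries.E2 =
    (12⁻¹ : ℂ) • (EisensteinSeries.E2 * EisensteinSeries.E2 - ⇑ModularForm.E₄) := by
  have hreg : IsRegular (D EisensteinSeries.E2 - (12⁻¹ : ℂ) •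
    (EisensteinSeries.E2 * EisensteinSeries.E2)) :=
    isRegular_E₂.derivative.sub ((isRegular_E₂.mul isRegular_E₂).smul _)
  have := (hreg.add (isRegular_E₄.smul (12⁻¹))).eq_zero_of_slash_invariant (k := 4) (by norm_num)
    (fun γ ↦ by
      have h1 := serreDerivative_E₂_slash γ
      have h2 := E₄_slash γ
      push_cast
      rw [SlashAction.add_slash, h1, ModularForm.SL_smul_slash, h2])
    (by
      rw [qExpansion_add hreg.analyticAt (isRegular_E₄.smul _).analyticAt,
        qExpansion_sub isRegular_E₂.derivative.analyticAt
          ((isRegular_E₂.mul isRegular_E₂).smul _).analyticAt,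
        qExpansion_smul (isRegular_E₂.mul isRegular_E₂).analyticAt,
        qExpansion_smul isRegular_E₄.analyticAt,
        qExpansion_mul isRegular_E₂.analyticAt isRegular_E₂.analyticAt]
      simp only [map_add, map_sub, isRegular_E₂.qExpansion_coeff_derivative, map_smul,
        PowerSeries.coeff_zero_eq_constantCoeff_apply,
        map_mul, constantCoeff_E₂, constantCoeff_E₄]
      norm_num)
  rw [smul_sub]
  linear_combination (exp := 1) this

lemma derivative_E₄ : D ModularForm.E₄ =
    (3⁻¹ : ℂ) • (EisensteinSeries.E2 * ModularForm.E₄ - ⇑ModularForm.E₆) := by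
  have hD : Derivative.serreDerivative (4 : ℤ) ModularForm.E₄ =
      D ModularForm.E₄ - (3⁻¹ : ℂ) • (EisensteinSeries.E2 * ModularForm.E₄) := by
    ext z
    simp
    ring
  have hreg : IsRegular (D ModularForm.E₄ - (3⁻¹ : ℂ) •
    (EisensteinSeries.E2 * ModularForm.E₄)) :=
    isRegular_E₄.derivative.sub ((isRegular_E₂.mul isRegular_E₄).smul _)
  have := (hreg.add (isRegular_E₆.smul (3⁻¹))).eq_zero_of_slash_invariant (k := 6) (by norm_num)
    (fun γ ↦ by
      have h1 : Derivative.serreDerivative (4 : ℤ) ModularForm.E₄ ∣[(6 : ℤ)] γ = _ :=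
        Derivative.serreDerivative_slash_invariant isRegular_E₄.mdiff (E₄_slash γ)
      have h2 := E₆_slash γ
      rw [hD] at h1
      push_cast
      rw [SlashAction.add_slash, h1, ModularForm.SL_smul_slash, h2])
    (by
      rw [qExpansion_add hreg.analyticAt (isRegular_E₆.smul _).analyticAt,
        qExpansion_sub isRegular_E₄.derivative.analyticAt
          ((isRegular_E₂.mul isRegular_E₄).smul _).analyticAt,
        qExpansion_smul (isRegular_E₂.mul isRegular_E₄).analyticAt,
        qExpansion_smul isRegular_E₆.analyticAt,
        qExpansion_mul isRegular_E₂.analyticAt isRegular_E₄.analyticAt]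
      simp only [map_add, map_sub, isRegular_E₄.qExpansion_coeff_derivative, map_smul,
        PowerSeries.coeff_zero_eq_constantCoeff_apply,
        map_mul, constantCoeff_E₂, constantCoeff_E₄, constantCoeff_E₆]
      norm_num)
  rw [smul_sub]
  linear_combination (exp := 1) this

lemma derivative_E₆ : D ModularForm.E₆ =
    (2⁻¹ : ℂ) • (EisensteinSeries.E2 * ModularForm.E₆ - ModularForm.E₄ * ⇑ModularForm.E₄) := by
  have hD : Derivative.serreDerivative (6 : ℤ) ModularForm.E₆ =
      D ModularForm.E₆ - (2⁻¹ : ℂ) • (EisensteinSeries.E2 * ModularForm.E₆) := by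
    ext z
    simp
    ring
  have hreg : IsRegular (D ModularForm.E₆ - (2⁻¹ : ℂ) •
    (EisensteinSeries.E2 * ModularForm.E₆)) :=
    isRegular_E₆.derivative.sub ((isRegular_E₂.mul isRegular_E₆).smul _)
  have hE44 := isRegular_E₄.mul isRegular_E₄
  have := (hreg.add (hE44.smul (2⁻¹))).eq_zero_of_slash_invariant (k := 8) (by norm_num)
    (fun γ ↦ by
      have h1 : Derivative.serreDerivative (6 : ℤ) ModularForm.E₆ ∣[(8 : ℤ)] γ = _ :=
        Derivative.serreDerivative_slash_invariant isRegular_E₆.mdiff (E₆_slash γ)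
      have h2 : (⇑ModularForm.E₄ * ModularForm.E₄) ∣[(8 : ℤ)] γ = _ :=
        ModularForm.mul_slash_SL2 4 4 γ ModularForm.E₄ ModularForm.E₄
      rw [E₄_slash] at h2
      rw [hD] at h1
      push_cast
      rw [SlashAction.add_slash, h1, ModularForm.SL_smul_slash, h2])
    (by
      rw [qExpansion_add hreg.analyticAt (hE44.smul _).analyticAt,
        qExpansion_sub isRegular_E₆.derivative.analyticAt
          ((isRegular_E₂.mul isRegular_E₆).smul _).analyticAt,
        qExpansion_smul (isRegular_E₂.mul isRegular_E₆).analyticAt,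
        qExpansion_smul hE44.analyticAt,
        qExpansion_mul isRegular_E₂.analyticAt isRegular_E₆.analyticAt,
        qExpansion_mul isRegular_E₄.analyticAt isRegular_E₄.analyticAt]
      simp only [map_add, map_sub, isRegular_E₆.qExpansion_coeff_derivative, map_smul,
        PowerSeries.coeff_zero_eq_constantCoeff_apply,
        map_mul, constantCoeff_E₂, constantCoeff_E₄, constantCoeff_E₆]
      norm_num)
  rw [smul_sub]
  linear_combination (exp := 1) this

end QuasimodularForm

/-! ### The recursion for extremal forms, as formal power series. -/

namespace QuasimodularForm

open PowerSeries

/-- The operator `q d/dq` on power series. -/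
noncomputable def qDeriv : Derivation ℂ ℂ⟦X⟧ ℂ⟦X⟧ := (X : ℂ⟦X⟧) • PowerSeries.derivative ℂ

local notation "θ" => qDeriv
local notation "e₂" => UpperHalfPlane.qExpansion 1 EisensteinSeries.E2
local notation "e₄" => UpperHalfPlane.qExpansion 1 ModularForm.E₄
local notation "e₆" => UpperHalfPlane.qExpansion 1 ModularForm.E₆

lemma coeff_qDeriv (F : ℂ⟦X⟧) (n : ℕ) : coeff n (θ F) = n * coeff n F := by
  rw [qDeriv, Derivation.smul_apply, smul_eq_mul]
  cases n with
  | zero => simp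
  | succ n => rw [coeff_succ_X_mul, coeff_derivative, mul_comm]; push_cast; rfl

lemma qDeriv_mul (F G : ℂ⟦X⟧) : θ (F * G) = F * θ G + G * θ F := by
  simp [Derivation.leibniz]

lemma qDeriv_C_mul (c : ℂ) (F : ℂ⟦X⟧) : θ (C c * F) = C c * θ F := by
  rw [← smul_eq_C_mul, ← smul_eq_C_mul, Derivation.map_smul]

lemma qDeriv_qExpansion {f : UpperHalfPlane → ℂ} (hf : IsRegular f) :
    θ (UpperHalfPlane.qExpansion 1 f) =
      UpperHalfPlane.qExpansion 1 (Derivative.normalizedDerivOfComplex f) := by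
  ext n
  rw [coeff_qDeriv, hf.qExpansion_coeff_derivative]

lemma C_inv_mul {c : ℂ} (hc : c ≠ 0) {F G : ℂ⟦X⟧} (h : F = c⁻¹ • G) : C c * F = G := by
  rw [h, ← smul_eq_C_mul, smul_smul, mul_inv_cancel₀ hc, one_smul]

lemma ramanujan_E₂ : 12 * θ e₂ = e₂ ^ 2 - e₄ := by
  have h : C (12 : ℂ) * θ e₂ = e₂ ^ 2 - e₄ := by
    refine C_inv_mul (by norm_num) ?_
    have h22 := isRegular_E₂.mul isRegular_E₂
    rw [qDeriv_qExpansion isRegular_E₂, derivative_E₂,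
      UpperHalfPlane.qExpansion_smul (h22.sub isRegular_E₄).analyticAt,
      UpperHalfPlane.qExpansion_sub h22.analyticAt isRegular_E₄.analyticAt,
      UpperHalfPlane.qExpansion_mul isRegular_E₂.analyticAt isRegular_E₂.analyticAt, sq]
  simpa only [map_ofNat] using h

lemma ramanujan_E₄ : 3 * θ e₄ = e₂ * e₄ - e₆ := by
  have h : C (3 : ℂ) * θ e₄ = e₂ * e₄ - e₆ := by
    refine C_inv_mul (by norm_num) ?_
    have h24 := isRegular_E₂.mul isRegular_E₄
    rw [qDeriv_qExpansion isRegular_E₄, derivative_E₄,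
      UpperHalfPlane.qExpansion_smul (h24.sub isRegular_E₆).analyticAt,
      UpperHalfPlane.qExpansion_sub h24.analyticAt isRegular_E₆.analyticAt,
      UpperHalfPlane.qExpansion_mul isRegular_E₂.analyticAt isRegular_E₄.analyticAt]
  simpa only [map_ofNat] using h

lemma ramanujan_E₆ : 2 * θ e₆ = e₂ * e₆ - e₄ ^ 2 := by
  have h : C (2 : ℂ) * θ e₆ = e₂ * e₆ - e₄ ^ 2 := by
    refine C_inv_mul (by norm_num) ?_
    have h26 := isRegular_E₂.mul isRegular_E₆
    have h44 := isRegular_E₄.mul isRegular_E₄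
    rw [qDeriv_qExpansion isRegular_E₆, derivative_E₆,
      UpperHalfPlane.qExpansion_smul (h26.sub h44).analyticAt,
      UpperHalfPlane.qExpansion_sub h26.analyticAt h44.analyticAt,
      UpperHalfPlane.qExpansion_mul isRegular_E₂.analyticAt isRegular_E₆.analyticAt,
      UpperHalfPlane.qExpansion_mul isRegular_E₄.analyticAt isRegular_E₄.analyticAt, sq]
  simpa only [map_ofNat] using h

/-- The `q`-expansions of the normalized extremal forms of weights `6 n` and `6 n + 2` and depth
`1`, defined by recursion. -/
noncomputable def extremal : ℕ → ℂ⟦X⟧ × ℂ⟦X⟧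
  | 0 => (1, e₂)
  | n + 1 =>
    (C ((n + 1) / (144 * (6 * n + 5)) : ℂ) * (e₄ * (extremal n).2 - e₆ * (extremal n).1),
      C ((n + 1) / (144 * (6 * n + 7)) : ℂ) * (e₄ ^ 2 * (extremal n).1 - e₆ * (extremal n).2))

lemma extremal_scalar_fst (n : ℕ) :
    (144 : ℂ⟦X⟧) * (6 * n + 5) * C ((n + 1) / (144 * (6 * n + 5)) : ℂ) = n + 1 := by
  have h : (144 : ℂ) * (6 * n + 5) * ((n + 1) / (144 * (6 * n + 5)) : ℂ) = n + 1 := by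
    have : (6 * n + 5 : ℂ) ≠ 0 := by exact_mod_cast (6 * n + 4).succ_ne_zero
    field_simp
  simpa only [map_mul, map_add, map_ofNat, map_natCast, map_one] using congrArg (C (R := ℂ)) h

lemma extremal_scalar_snd (n : ℕ) :
    (144 : ℂ⟦X⟧) * (6 * n + 7) * C ((n + 1) / (144 * (6 * n + 7)) : ℂ) = n + 1 := by
  have h : (144 : ℂ) * (6 * n + 7) * ((n + 1) / (144 * (6 * n + 7)) : ℂ) = n + 1 := by
    have : (6 * n + 7 : ℂ) ≠ 0 := by exact_mod_cast (6 * n + 6).succ_ne_zero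
    field_simp
  simpa only [map_mul, map_add, map_ofNat, map_natCast, map_one] using congrArg (C (R := ℂ)) h

/-- This proportion between the two normalizing scalars is what lets the linear system reproduce
itself from n to n+1. -/
lemma extremal_scalar_eq (n : ℕ) :
    (6 * n + 7 : ℂ⟦X⟧) * C ((n + 1) / (144 * (6 * n + 7)) : ℂ) =
      (6 * n + 5) * C ((n + 1) / (144 * (6 * n + 5)) : ℂ) := by
  have h1 := extremal_scalar_fst n
  have h2 := extremal_scalar_snd n
  have h144 : (144 : ℂ⟦X⟧) ≠ 0 := by
    have := (map_ne_zero_iff (C (R := ℂ)) C_injective).mpr (show (144 : ℂ) ≠ 0 by norm_num)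
    simpa only [map_ofNat] using this
  exact mul_left_cancel₀ h144 (by linear_combination h2 - h1)

/-- The first order linear system satisfied by a pair of extremal forms. -/
lemma extremal_system (n : ℕ) :
    12 * θ (extremal n).1 = (6 * n - 1) * e₂ * (extremal n).1 + (6 * n + 1) * (extremal n).2 ∧
    12 * θ (extremal n).2 =
      (6 * n + 1) * e₂ * (extremal n).2 + (6 * n - 1) * e₄ * (extremal n).1 := by
  induction n with
  | zero =>
    simp only [extremal, Derivation.map_one_eq_zero, ramanujan_E₂]
    push_cast
    constructor <;> ring
  | succ n ih =>
    obtain ⟨h1, h2⟩ := ih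
    have hs := extremal_scalar_eq n
    simp only [extremal, qDeriv_C_mul]
    simp only [map_sub, qDeriv_mul, sq]
    set P := (extremal n).1
    set Q := (extremal n).2
    set u := C ((n + 1) / (144 * (6 * n + 5)) : ℂ)
    set v := C ((n + 1) / (144 * (6 * n + 7)) : ℂ)
    have h4 := ramanujan_E₄
    have h6 := ramanujan_E₆
    push_cast
    constructor
    · linear_combination u * (4 * h4 * Q + e₄ * h2 - 6 * h6 * P - e₆ * h1)
        - (e₄ ^ 2 * P - e₆ * Q) * hs
    · linear_combination v * (8 * e₄ * h4 * P + e₄ ^ 2 * h1 - 6 * h6 * Q - e₆ * h2)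
        + e₄ * (e₄ * Q - e₆ * P) * hs

/-- In the system at n+1, E₂(E₄Q − E₆P) + (E₄²P − E₆Q) regroups as (E₂E₄ − E₆)Q + (E₄² − E₂E₆)P,
whose brackets are Ramanujan's 3θE₄ and −2θE₆. The minus signs of the recursion are thereby
absorbed. Here 1728 = 12 · 144. -/
lemma extremal_qDeriv_fst (n : ℕ) : 1728 * θ (extremal (n + 1)).1 =
    (n + 1) * (3 * θ e₄ * (extremal n).2 + -(2 * θ e₆) * (extremal n).1) := by
  obtain ⟨h, -⟩ := extremal_system (n + 1)
  have hu := extremal_scalar_fst n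
  have hv := extremal_scalar_snd n
  rw [ramanujan_E₄, ramanujan_E₆]
  simp only [extremal] at h ⊢
  push_cast at h
  linear_combination 144 * h + e₂ * (e₄ * (extremal n).2 - e₆ * (extremal n).1) * hu +
    (e₄ ^ 2 * (extremal n).1 - e₆ * (extremal n).2) * hv

lemma extremal_qDeriv_snd (n : ℕ) : 1728 * θ (extremal (n + 1)).2 =
    (n + 1) * (e₄ * (3 * θ e₄) * (extremal n).1 + -(2 * θ e₆) * (extremal n).2) := by
  obtain ⟨-, h⟩ := extremal_system (n + 1)
  have hu := extremal_scalar_fst n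
  have hv := extremal_scalar_snd n
  rw [ramanujan_E₄, ramanujan_E₆]
  simp only [extremal] at h ⊢
  push_cast at h
  linear_combination 144 * h + e₂ * (e₄ ^ 2 * (extremal n).1 - e₆ * (extremal n).2) * hv +
    e₄ * (e₄ * (extremal n).2 - e₆ * (extremal n).1) * hu

/-! ### Leading terms. -/

/-- `F = q ^ n + O(q ^ (n + 1))`. -/
def HasLeading (n : ℕ) (F : ℂ⟦X⟧) : Prop := (∀ k < n, coeff k F = 0) ∧ coeff n F = 1

lemma coeff_mul_of_lt {n k : ℕ} (G : ℂ⟦X⟧) {F : ℂ⟦X⟧} (h : ∀ k < n, coeff k F = 0) (hk : k < n) :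
    coeff k (G * F) = 0 := by
  obtain ⟨F, rfl⟩ := X_pow_dvd_iff.mpr h
  rw [mul_left_comm]
  exact X_pow_dvd_iff.mp (dvd_mul_right _ _) k hk

lemma coeff_mul_eq {n : ℕ} (G : ℂ⟦X⟧) {F : ℂ⟦X⟧} (h : ∀ k < n, coeff k F = 0) :
    coeff n (G * F) = constantCoeff G * coeff n F := by
  obtain ⟨F, rfl⟩ := X_pow_dvd_iff.mpr h
  rw [mul_left_comm]
  have h1 := coeff_X_pow_mul (G * F) n 0
  have h2 := coeff_X_pow_mul F n 0
  rw [zero_add] at h1 h2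
  rw [h1, h2]
  simp

lemma coeff_succ_mul_eq {n : ℕ} (G : ℂ⟦X⟧) {F : ℂ⟦X⟧} (h : ∀ k < n, coeff k F = 0) :
    coeff (n + 1) (G * F) = constantCoeff G * coeff (n + 1) F + coeff 1 G * coeff n F := by
  obtain ⟨F, rfl⟩ := X_pow_dvd_iff.mpr h
  rw [mul_left_comm, add_comm n 1, coeff_X_pow_mul, coeff_X_pow_mul]
  have := coeff_X_pow_mul F n 0
  rw [zero_add] at this
  rw [this, coeff_mul, Finset.Nat.antidiagonal_succ]
  simp

lemma HasLeading.mul {n : ℕ} {F G : ℂ⟦X⟧} (hF : HasLeading n F) (hG : constantCoeff G = 1) :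
    HasLeading n (G * F) :=
  ⟨fun _ ↦ coeff_mul_of_lt G hF.1, by rw [coeff_mul_eq G hF.1, hG, hF.2, one_mul]⟩

lemma coeff_e₂_one : coeff 1 e₂ = -24 := by simp [qExpansion_E₂_coeff]
lemma coeff_e₄_one : coeff 1 e₄ = 240 := by simp [qExpansion_E₄_coeff]
lemma coeff_e₆_one : coeff 1 e₆ = -504 := by simp [qExpansion_E₆_coeff]

lemma coeff_natCast_mul (a m : ℕ) (F : ℂ⟦X⟧) : coeff m ((a : ℂ⟦X⟧) * F) = a * coeff m F := by
  rw [← map_natCast (C (R := ℂ)), coeff_C_mul]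

lemma coeff_extremal_system (n m : ℕ) :
    12 * m * coeff m (extremal n).1 =
      (6 * n - 1) * coeff m (e₂ * (extremal n).1) + (6 * n + 1) * coeff m (extremal n).2 ∧
    12 * m * coeff m (extremal n).2 =
      (6 * n + 1) * coeff m (e₂ * (extremal n).2) +
        (6 * n - 1) * coeff m (e₄ * (extremal n).1) := by
  obtain ⟨h1, h2⟩ := extremal_system n
  have h1 := congrArg (coeff m) h1
  have h2 := congrArg (coeff m) h2
  have e : (6 * n : ℂ⟦X⟧) = C (6 * n : ℂ) := by
    rw [map_mul, map_natCast, map_ofNat]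
  have e12 : (12 : ℂ⟦X⟧) = C (12 : ℂ) := by rw [map_ofNat]
  have e1 : (1 : ℂ⟦X⟧) = C (1 : ℂ) := by rw [map_one]
  rw [e, e1, e12, ← map_sub, ← map_add, mul_assoc, map_add (coeff m)] at h1 h2
  rw [mul_assoc (C _)] at h2
  simp only [coeff_C_mul, coeff_qDeriv] at h1 h2
  exact ⟨by rw [mul_assoc, h1], by rw [mul_assoc, h2]⟩

/-- The q^n terms of the recursion cancel because all constant terms are 1. For q^(n+1) only the
difference of the next coefficients of P_n and Q_n matters, and subtracting the two equations of the
system at that index yields it: (n+1)(q − p) = 120n − 24, where p, q are those coefficients. -/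
lemma hasLeading_extremal (n : ℕ) :
    HasLeading n (extremal n).1 ∧ HasLeading n (extremal n).2 := by
  induction n with
  | zero => exact ⟨⟨by simp, by simp [extremal]⟩, ⟨by simp, by simp [extremal, constantCoeff_E₂]⟩⟩
  | succ n ih =>
    obtain ⟨hP, hQ⟩ := ih
    obtain ⟨h1, h2⟩ := coeff_extremal_system n (n + 1)
    have n5 : (6 * n + 5 : ℂ) ≠ 0 := by exact_mod_cast (6 * n + 4).succ_ne_zero
    have n7 : (6 * n + 7 : ℂ) ≠ 0 := by exact_mod_cast (6 * n + 6).succ_ne_zero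
    rw [coeff_succ_mul_eq _ hP.1, hP.2, constantCoeff_E₂, coeff_e₂_one] at h1
    rw [coeff_succ_mul_eq _ hP.1, coeff_succ_mul_eq _ hQ.1, hP.2, hQ.2, constantCoeff_E₂,
      constantCoeff_E₄, coeff_e₂_one, coeff_e₄_one] at h2
    have c1 : coeff 1 (e₄ ^ 2) = 480 := by
      rw [sq]
      have := coeff_succ_mul_eq (n := 0) e₄ (F := e₄) (by simp)
      simp [constantCoeff_E₄, coeff_e₄_one] at this
      rw [this]; norm_num
    push_cast at h1 h2
    refine ⟨⟨fun k hk ↦ ?_, ?_⟩, ⟨fun k hk ↦ ?_, ?_⟩⟩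
    · rw [extremal, coeff_C_mul, map_sub]
      rcases Nat.lt_succ_iff_lt_or_eq.mp hk with hk | rfl
      · rw [coeff_mul_of_lt _ hP.1 hk, coeff_mul_of_lt _ hQ.1 hk, sub_zero, mul_zero]
      · rw [coeff_mul_eq _ hP.1, coeff_mul_eq _ hQ.1, hP.2, hQ.2, constantCoeff_E₄,
          constantCoeff_E₆, sub_self, mul_zero]
    · rw [extremal, coeff_C_mul, map_sub, coeff_succ_mul_eq _ hP.1, coeff_succ_mul_eq _ hQ.1,
        hP.2, hQ.2, constantCoeff_E₄, constantCoeff_E₆, coeff_e₄_one, coeff_e₆_one]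
      rw [div_mul_eq_mul_div, div_eq_iff (mul_ne_zero (by norm_num) n5)]
      linear_combination (h2 - h1) / 12
    · rw [extremal, coeff_C_mul, map_sub]
      rcases Nat.lt_succ_iff_lt_or_eq.mp hk with hk | rfl
      · rw [coeff_mul_of_lt _ hP.1 hk, coeff_mul_of_lt _ hQ.1 hk, sub_zero, mul_zero]
      · rw [coeff_mul_eq _ hP.1, coeff_mul_eq _ hQ.1, hP.2, hQ.2, map_pow, constantCoeff_E₄,
          constantCoeff_E₆, one_pow, sub_self, mul_zero]
    · rw [extremal, coeff_C_mul, map_sub, coeff_succ_mul_eq _ hP.1, coeff_succ_mul_eq _ hQ.1,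
        hP.2, hQ.2, map_pow, constantCoeff_E₄, constantCoeff_E₆, c1, coeff_e₆_one]
      rw [div_mul_eq_mul_div, div_eq_iff (mul_ne_zero (by norm_num) n7)]
      linear_combination (h1 - h2) / 12

/-! ### Positivity of the coefficients. -/

open scoped ComplexOrder

/-- The coefficients of `F` vanish below `n` and are positive reals from `n` on. -/
def PosFrom (n : ℕ) (F : ℂ⟦X⟧) : Prop := (∀ k < n, coeff k F = 0) ∧ ∀ k, n ≤ k → 0 < coeff k F

namespace PosFrom

variable {m n : ℕ} {F G : ℂ⟦X⟧}

lemma nonneg (hF : PosFrom n F) (k : ℕ) : 0 ≤ coeff k F := by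
  rcases lt_or_ge k n with h | h
  · exact (hF.1 k h).ge
  · exact (hF.2 k h).le

lemma add (hF : PosFrom n F) (hG : PosFrom n G) : PosFrom n (F + G) :=
  ⟨fun k hk ↦ by rw [map_add, hF.1 k hk, hG.1 k hk, add_zero],
    fun k hk ↦ by rw [map_add]; exact add_pos (hF.2 k hk) (hG.2 k hk)⟩

lemma C_mul {c : ℂ} (hc : 0 < c) (hF : PosFrom n F) : PosFrom n (C c * F) :=
  ⟨fun k hk ↦ by rw [coeff_C_mul, hF.1 k hk, mul_zero],
    fun k hk ↦ by rw [coeff_C_mul]; exact mul_pos hc (hF.2 k hk)⟩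

lemma mul (hF : PosFrom m F) (hG : PosFrom n G) : PosFrom (m + n) (F * G) := by
  constructor
  · intro k hk
    rw [coeff_mul]
    refine Finset.sum_eq_zero fun p hp ↦ ?_
    rw [Finset.HasAntidiagonal.mem_antidiagonal] at hp
    rcases lt_or_ge p.1 m with h | h
    · rw [hF.1 _ h, zero_mul]
    · rw [hG.1 p.2 (by omega), mul_zero]
  · intro k hk
    rw [coeff_mul]
    -- All terms of the Cauchy product are nonnegative, and the one at (m, k − m) is strictly
    -- positive.
    refine Finset.sum_pos' (fun p _ ↦ mul_nonneg (hF.nonneg _) (hG.nonneg _))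
      ⟨(m, k - m), ?_, mul_pos (hF.2 _ le_rfl) (hG.2 _ (by omega))⟩
    rw [Finset.HasAntidiagonal.mem_antidiagonal]
    omega

/-- θ multiplies the k-th coefficient by k, so signs pull back through it except at k = 0, where
vanishing must be assumed. -/
lemma of_qDeriv {a b : ℕ} (ha : 0 < a) (hb : 0 < b) (hn : 0 < n) (h0 : coeff 0 F = 0)
    (hG : PosFrom n G) (h : (a : ℂ⟦X⟧) * θ F = b * G) : PosFrom n F := by
  have key (k : ℕ) : (a * k : ℂ) * coeff k F = b * coeff k G := by
    have := congrArg (coeff k) h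
    rwa [coeff_natCast_mul, coeff_natCast_mul, coeff_qDeriv, ← mul_assoc] at this
  have ha' : (0 : ℂ) < a := by exact_mod_cast ha
  have hb' : (0 : ℂ) < b := by exact_mod_cast hb
  constructor
  · intro k hk
    rcases Nat.eq_zero_or_pos k with rfl | hk0
    · exact h0
    · have := key k
      rw [hG.1 k hk, mul_zero] at this
      have hk' : (k : ℂ) ≠ 0 := by exact_mod_cast hk0.ne'
      exact (mul_eq_zero.mp this).resolve_left (mul_ne_zero ha'.ne' hk')
  · intro k hk
    have hk' : (0 : ℂ) < k := by exact_mod_cast (hn.trans_le hk)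
    have : coeff k F = (a * k : ℂ)⁻¹ * (b * coeff k G) := by
      rw [← key, inv_mul_cancel_left₀ (mul_pos ha' hk').ne']
    rw [this]
    exact mul_pos (inv_pos.mpr (mul_pos ha' hk')) (mul_pos hb' (hG.2 k hk))

end PosFrom

lemma sigma_cast_pos (a : ℕ) {k : ℕ} (hk : 0 < k) :
    (0 : ℂ) < (ArithmeticFunction.sigma a k : ℂ) := by
  exact_mod_cast ArithmeticFunction.sigma_pos a k hk.ne'

lemma posFrom_e₄ : PosFrom 0 e₄ := by
  refine ⟨by simp, fun k _ ↦ ?_⟩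
  rw [qExpansion_E₄_coeff]
  split_ifs with h
  · exact one_pos
  · exact mul_pos (by norm_num) (sigma_cast_pos 3 (Nat.pos_of_ne_zero h))

lemma posFrom_qDeriv_e₄ : PosFrom 1 (3 * θ e₄) := by
  have e3 : (3 : ℂ⟦X⟧) = ((3 : ℕ) : ℂ⟦X⟧) := by norm_num
  rw [e3]
  constructor
  · intro k hk
    obtain rfl : k = 0 := by omega
    rw [coeff_natCast_mul, coeff_qDeriv]; simp
  · intro k hk
    rw [coeff_natCast_mul, coeff_qDeriv, qExpansion_E₄_coeff, if_neg (by omega)]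
    have : (0 : ℂ) < k := by exact_mod_cast hk
    exact mul_pos (by norm_num) (mul_pos this (mul_pos (by norm_num) (sigma_cast_pos 3 hk)))

lemma posFrom_qDeriv_e₆ : PosFrom 1 (-(2 * θ e₆)) := by
  have e2 : (2 : ℂ⟦X⟧) = ((2 : ℕ) : ℂ⟦X⟧) := by norm_num
  rw [e2]
  constructor
  · intro k hk
    obtain rfl : k = 0 := by omega
    rw [map_neg, coeff_natCast_mul, coeff_qDeriv]; simp
  · intro k hk
    rw [map_neg, coeff_natCast_mul, coeff_qDeriv, qExpansion_E₆_coeff, if_neg (by omega)]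
    have : (0 : ℂ) < k := by exact_mod_cast hk
    have := mul_pos (show (0 : ℂ) < 1008 by norm_num) (mul_pos this (sigma_cast_pos 5 hk))
    convert this using 1
    push_cast
    ring

/-- The induction starts at index 1 because E₂ has negative coefficients; there the pair is a
positive multiple of (3θE₄, −2θE₆). -/
lemma posFrom_extremal (n : ℕ) :
    PosFrom (n + 1) (extremal (n + 1)).1 ∧ PosFrom (n + 1) (extremal (n + 1)).2 := by
  induction n with
  | zero =>
    have h4 := posFrom_qDeriv_e₄
    have h6 := posFrom_qDeriv_e₆
    rw [ramanujan_E₄] at h4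
    rw [ramanujan_E₆] at h6
    simp only [extremal, zero_add]
    refine ⟨.C_mul (by norm_num) ?_, .C_mul (by norm_num) ?_⟩
    · rwa [mul_one, mul_comm]
    · rwa [mul_one, mul_comm, ← neg_sub]
  | succ n ih =>
    obtain ⟨hP, hQ⟩ := hasLeading_extremal (n + 1 + 1)
    have h1 := extremal_qDeriv_fst (n + 1)
    have h2 := extremal_qDeriv_snd (n + 1)
    refine ⟨.of_qDeriv (a := 1728) (b := n + 1 + 1) (by norm_num) (by omega) (by omega)
      (hP.1 0 (by omega)) (G := _) ?_ (by push_cast at h1 ⊢; exact h1),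
      .of_qDeriv (a := 1728) (b := n + 1 + 1) (by norm_num) (by omega) (by omega)
      (hQ.1 0 (by omega)) (G := _) ?_ (by push_cast at h2 ⊢; exact h2)⟩
    · rw [add_comm (n + 1) 1]
      exact (posFrom_qDeriv_e₄.mul ih.2).add (posFrom_qDeriv_e₆.mul ih.1)
    · rw [add_comm (n + 1) 1]
      refine .add (.mul ?_ ih.1) (posFrom_qDeriv_e₆.mul ih.2)
      simpa using posFrom_e₄.mul posFrom_qDeriv_e₄

/-! ### The spaces of quasimodular forms and their dimension in depth 1. -/

open UpperHalfPlane
open scoped MatrixGroups ModularForm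

/-- The monomial `E₂ ^ a * E₄ ^ b * E₆ ^ c`. -/
noncomputable def eisensteinMonomial (a b c : ℕ) : ℍ → ℂ :=
  EisensteinSeries.E2 ^ a * (⇑ModularForm.E₄) ^ b * (⇑ModularForm.E₆) ^ c

lemma isRegular_eisensteinMonomial (a b c : ℕ) : IsRegular (eisensteinMonomial a b c) :=
  ((isRegular_E₂.pow a).mul (isRegular_E₄.pow b)).mul (isRegular_E₆.pow c)

lemma qExpansion_eisensteinMonomial (a b c : ℕ) :
    qExpansion 1 (eisensteinMonomial a b c) = e₂ ^ a * e₄ ^ b * e₆ ^ c := by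
  rw [eisensteinMonomial,
    qExpansion_mul ((isRegular_E₂.pow a).mul (isRegular_E₄.pow b)).analyticAt
      (isRegular_E₆.pow c).analyticAt,
    qExpansion_mul (isRegular_E₂.pow a).analyticAt (isRegular_E₄.pow b).analyticAt,
    isRegular_E₂.qExpansion_pow, isRegular_E₄.qExpansion_pow, isRegular_E₆.qExpansion_pow]

lemma eisensteinMonomial_mem {w s a b c : ℕ} (ha : a ≤ s) (h : 2 * a + 4 * b + 6 * c = w) :
    eisensteinMonomial a b c ∈ QM w s :=
  Submodule.subset_span ⟨a, b, c, ha, h, rfl⟩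

lemma isRegular_of_mem {w s : ℕ} {f : ℍ → ℂ} (hf : f ∈ QM w s) : IsRegular f := by
  induction hf using Submodule.span_induction with
  | mem f hf =>
    obtain ⟨a, b, c, -, -, rfl⟩ := hf
    exact isRegular_eisensteinMonomial a b c
  | zero => exact .const 0
  | add f g _ _ hf hg => exact hf.add hg
  | smul c f _ hf => exact hf.smul c

/-- The `q`-expansion as a linear map on quasimodular forms. -/
noncomputable def qExpansionLinear (w s : ℕ) : QM w s →ₗ[ℂ] ℂ⟦X⟧ where
  toFun f := qExpansion 1 (f : ℍ → ℂ)
  map_add' f g := qExpansion_add (isRegular_of_mem f.2).analyticAt (isRegular_of_mem g.2).analyticAt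
  map_smul' c f := qExpansion_smul (isRegular_of_mem f.2).analyticAt c

/-- The space of `q`-expansions of quasimodular forms. -/
noncomputable def qSpace (w s : ℕ) : Submodule ℂ ℂ⟦X⟧ := LinearMap.range (qExpansionLinear w s)

lemma monomial_mem_qSpace {w s a b c : ℕ} (ha : a ≤ s) (h : 2 * a + 4 * b + 6 * c = w) :
    e₂ ^ a * e₄ ^ b * e₆ ^ c ∈ qSpace w s :=
  ⟨⟨_, eisensteinMonomial_mem ha h⟩, qExpansion_eisensteinMonomial a b c⟩

lemma mul_mem_qSpace {w s : ℕ} {F : ℂ⟦X⟧} (hF : F ∈ qSpace w s) (b c : ℕ) {w' : ℕ}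
    (hw : w + 4 * b + 6 * c = w') : e₄ ^ b * e₆ ^ c * F ∈ qSpace w' s := by
  obtain ⟨⟨f, hf⟩, rfl⟩ := hF
  change e₄ ^ b * e₆ ^ c * qExpansion 1 f ∈ _
  induction hf using Submodule.span_induction with
  | mem f hf =>
    obtain ⟨a', b', c', ha, h, rfl⟩ := hf
    change _ * qExpansion 1 (eisensteinMonomial a' b' c') ∈ _
    rw [qExpansion_eisensteinMonomial]
    have := monomial_mem_qSpace (w := w') (b := b + b') (c := c + c') ha (by omega)
    convert this using 1
    ring
  | zero => rw [qExpansion_zero, mul_zero]; exact zero_mem _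
  | add f g hf hg ihf ihg =>
    rw [qExpansion_add (isRegular_of_mem hf).analyticAt (isRegular_of_mem hg).analyticAt, mul_add]
    exact add_mem ihf ihg
  | smul c f hf ih =>
    rw [qExpansion_smul (isRegular_of_mem hf).analyticAt, mul_smul_comm]
    exact Submodule.smul_mem _ _ ih

lemma extremal_mem_qSpace (n : ℕ) :
    (extremal n).1 ∈ qSpace (6 * n) 1 ∧ (extremal n).2 ∈ qSpace (6 * n + 2) 1 := by
  induction n with
  | zero =>
    constructor
    · simpa [extremal] using monomial_mem_qSpace (a := 0) (b := 0) (c := 0) (zero_le_one) rfl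
    · simpa [extremal] using monomial_mem_qSpace (a := 1) (b := 0) (c := 0) le_rfl rfl
  | succ n ih =>
    obtain ⟨hP, hQ⟩ := ih
    simp only [extremal, ← smul_eq_C_mul]
    refine ⟨Submodule.smul_mem _ _ (sub_mem ?_ ?_), Submodule.smul_mem _ _ (sub_mem ?_ ?_)⟩
    · simpa using mul_mem_qSpace hQ 1 0 (by ring)
    · simpa using mul_mem_qSpace hP 0 1 (by ring)
    · simpa using mul_mem_qSpace hP 2 0 (by ring)
    · simpa using mul_mem_qSpace hQ 0 1 (by ring)

/-- For each `j ≤ h / 3`, a `q`-expansion of weight `2 h` and depth at most `1` with leading term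
`q ^ j`. -/
noncomputable def leadingForm (h j : ℕ) : ℂ⟦X⟧ :=
  e₄ ^ ((h - 3 * j) / 2) * if (h - 3 * j) % 2 = 0 then (extremal j).1 else (extremal j).2

lemma leadingForm_mem {h j : ℕ} (hj : 3 * j ≤ h) : leadingForm h j ∈ qSpace (2 * h) 1 := by
  rw [leadingForm]
  split_ifs with hp
  · simpa using mul_mem_qSpace (extremal_mem_qSpace j).1 ((h - 3 * j) / 2) 0 (by omega)
  · simpa using mul_mem_qSpace (extremal_mem_qSpace j).2 ((h - 3 * j) / 2) 0 (by omega)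

lemma hasLeading_leadingForm (h j : ℕ) : HasLeading j (leadingForm h j) := by
  rw [leadingForm]
  refine .mul ?_ (by rw [map_pow, constantCoeff_E₄, one_pow])
  split_ifs
  · exact (hasLeading_extremal j).1
  · exact (hasLeading_extremal j).2

lemma posFrom_leadingForm (h : ℕ) {j : ℕ} (hj : 1 ≤ j) : PosFrom j (leadingForm h j) := by
  obtain ⟨j, rfl⟩ := Nat.exists_eq_add_of_le' hj
  have hb {G : ℂ⟦X⟧} (hG : PosFrom (j + 1) G) (b : ℕ) : PosFrom (j + 1) (e₄ ^ b * G) := by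
    induction b with
    | zero => rwa [pow_zero, one_mul]
    | succ b ih =>
      rw [pow_succ', mul_assoc]
      simpa using posFrom_e₄.mul ih
  rw [leadingForm]
  refine hb ?_ _
  split_ifs
  · exact (posFrom_extremal j).1
  · exact (posFrom_extremal j).2

/-- The spanning monomials of weight `2 h` and depth at most `1` are indexed by the exponent of
`E₆`. -/
lemma QM_one_le_span (h : ℕ) : QM (2 * h) 1 ≤ Submodule.span ℂ (Set.range fun c : Fin (h / 3 + 1) ↦
    eisensteinMonomial ((h - 3 * c) % 2) ((h - 3 * c) / 2) c) := by
  refine Submodule.span_mono ?_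
  rintro _ ⟨a, b, c, ha, hw, rfl⟩
  refine ⟨⟨c, by omega⟩, ?_⟩
  -- Half the weight gives a + 2b = h − 3c with a ≤ 1, a division by 2 with remainder.
  have h1 : (h - 3 * c) % 2 = a := by omega
  have h2 : (h - 3 * c) / 2 = b := by omega
  simp only [h1, h2]
  rfl

instance (h : ℕ) : Module.Finite ℂ (QM (2 * h) 1) :=
  have := FiniteDimensional.span_of_finite ℂ (Set.finite_range fun c : Fin (h / 3 + 1) ↦
    eisensteinMonomial ((h - 3 * c) % 2) ((h - 3 * c) / 2) c)
  Submodule.finiteDimensional_of_le (QM_one_le_span h)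

lemma finrank_QM_le (h : ℕ) : Module.finrank ℂ (QM (2 * h) 1) ≤ h / 3 + 1 := by
  have := FiniteDimensional.span_of_finite ℂ (Set.finite_range fun c : Fin (h / 3 + 1) ↦
    eisensteinMonomial ((h - 3 * c) % 2) ((h - 3 * c) / 2) c)
  refine (Submodule.finrank_mono (QM_one_le_span h)).trans ?_
  simpa [Set.finrank] using finrank_range_le_card (R := ℂ) (fun c : Fin (h / 3 + 1) ↦
    eisensteinMonomial ((h - 3 * c) % 2) ((h - 3 * c) / 2) c)

/-- The first `h / 3 + 1` Fourier coefficients. -/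
noncomputable def initialCoeffs (h : ℕ) : QM (2 * h) 1 →ₗ[ℂ] (Fin (h / 3 + 1) → ℂ) :=
  LinearMap.pi fun j ↦ (coeff (j : ℕ)).comp (qExpansionLinear (2 * h) 1)

lemma exists_leadingForm {h j : ℕ} (hj : 3 * j ≤ h) :
    ∃ f : QM (2 * h) 1, qExpansion 1 (f : ℍ → ℂ) = leadingForm h j :=
  leadingForm_mem hj

/-- The leading forms have a unitriangular matrix of initial coefficients, so they are independent
and attain the upper bound on the dimension. The initial coefficient map is then surjective between
spaces of equal dimension, hence injective. -/
lemma finrank_QM_and_injective (h : ℕ) : Module.finrank ℂ (QM (2 * h) 1) = h / 3 + 1 ∧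
    Function.Injective (initialCoeffs h) := by
  choose g hg using fun j : Fin (h / 3 + 1) ↦ exists_leadingForm (h := h) (j := j) (by omega)
  set M : Matrix (Fin (h / 3 + 1)) (Fin (h / 3 + 1)) ℂ := .of fun i ↦ initialCoeffs h (g i) with hM
  have hentry (i j) : M i j = coeff (j : ℕ) (leadingForm h i) := by
    rw [← hg i]; rfl
  have hdet : M.det = 1 := by
    rw [Matrix.det_of_isUpperTriangular]
    · exact Finset.prod_eq_one fun i _ ↦ by rw [hentry, (hasLeading_leadingForm h i).2]
    · intro i j hij
      rw [hentry, (hasLeading_leadingForm h i).1 j hij]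
  have hli : LinearIndependent ℂ (initialCoeffs h ∘ g) :=
    Matrix.linearIndependent_rows_of_det_ne_zero (A := M) (by rw [hdet]; exact one_ne_zero)
  have hge := (LinearIndependent.of_comp _ hli).fintype_card_le_finrank
  rw [Fintype.card_fin] at hge
  have hfin := le_antisymm (finrank_QM_le h) hge
  refine ⟨hfin, ?_⟩
  rw [LinearMap.injective_iff_surjective_of_finrank_eq_finrank (by simp [hfin]),
    ← LinearMap.range_eq_top, eq_top_iff,
    ← hli.span_eq_top_of_card_eq_finrank (by simp), Submodule.span_le]
  rintro _ ⟨i, rfl⟩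
  exact ⟨g i, rfl⟩

/-! ### Exact depth, uniqueness and the conclusion. -/

/-- Depth `0` forms are modular forms. -/
lemma exists_modularForm {w : ℕ} {f : ℍ → ℂ} (hf : f ∈ QM w 0) :
    ∃ F : ModularForm 𝒮ℒ (w : ℤ), ⇑F = f := by
  induction hf using Submodule.span_induction with
  | mem f hf =>
    obtain ⟨a, b, c, ha, rfl, rfl⟩ := hf
    obtain rfl : a = 0 := by omega
    refine ⟨.mcast ?_ ((ModularForm.E₄.pow b).mul (ModularForm.E₆.pow c)), ?_⟩
    · push_cast; ring
    · ext z
      simp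
  | zero => exact ⟨0, rfl⟩
  | add f g _ _ hf hg =>
    obtain ⟨F, rfl⟩ := hf
    obtain ⟨G, rfl⟩ := hg
    exact ⟨F + G, rfl⟩
  | smul c f _ hf =>
    obtain ⟨F, rfl⟩ := hf
    exact ⟨c • F, rfl⟩

/-- A nonzero modular form of weight 2h vanishes to order at most 2h/12 at infinity, and ⌊2h/12⌋ <
⌊h/3⌋ as soon as h ≥ 3. -/
lemma not_mem_QM_zero {h : ℕ} (hh : 3 ≤ h) {f : ℍ → ℂ} (hf : HasLeading (h / 3) (qExpansion 1 f)) :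
    f ∉ QM (2 * h) 0 := by
  intro hm
  obtain ⟨F, rfl⟩ := exists_modularForm hm
  have : F = 0 := by
    apply ModularForm.sturm_bound_levelOne_nat
    refine lt_of_lt_of_le ?_ (nat_le_order _ (h / 3) hf.1)
    norm_cast
    omega
  have h1 := hf.2
  rw [this] at h1
  change coeff _ (qExpansion 1 (0 : ℍ → ℂ)) = 1 at h1
  rw [qExpansion_zero] at h1
  simp at h1

lemma isNormalizedExtremal_iff {h : ℕ} (hh : 3 ≤ h) {f : ℍ → ℂ} :
    IsNormalizedExtremal (2 * h) 1 f ↔ f ∈ QM (2 * h) 1 ∧ HasLeading (h / 3) (qExpansion 1 f) := by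
  have hfin := (finrank_QM_and_injective h).1
  constructor
  · intro hf
    have h1 := hf.vanishing
    have h2 := hf.normalized
    rw [hfin] at h1 h2
    exact ⟨hf.mem, fun k hk ↦ h1 k (by omega), h2⟩
  · rintro ⟨hm, hl⟩
    have h2 : fourierCoeff f (Module.finrank ℂ (QM (2 * h) 1) - 1) = 1 := by
      rw [hfin]; exact hl.2
    refine ⟨⟨hm, fun t ht ↦ ?_, fun n hn ↦ ?_, ?_⟩, h2⟩
    · obtain rfl : t = 0 := by omega
      exact not_mem_QM_zero hh hl
    · rw [hfin] at hn
      exact hl.1 n (by omega)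
    · rw [h2]; exact one_ne_zero

lemma eq_of_hasLeading {h : ℕ} {f g : ℍ → ℂ} (hf : f ∈ QM (2 * h) 1) (hg : g ∈ QM (2 * h) 1)
    (hfl : HasLeading (h / 3) (qExpansion 1 f)) (hgl : HasLeading (h / 3) (qExpansion 1 g)) :
    f = g := by
  have : (⟨f, hf⟩ : QM (2 * h) 1) = ⟨g, hg⟩ := by
    apply (finrank_QM_and_injective h).2
    ext j
    change coeff (j : ℕ) (qExpansion 1 f) = coeff (j : ℕ) (qExpansion 1 g)
    rcases Nat.lt_succ_iff_lt_or_eq.mp j.2 with hj | hj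
    · rw [hfl.1 _ hj, hgl.1 _ hj]
    · rw [hj, hfl.2, hgl.2]
  exact congrArg Subtype.val this

open scoped ComplexOrder in
-- In the order on ℂ, 0 < z already forces z to be real, so `PosFrom` carries the reality of the
-- coefficients.
lemma exists_real_of_pos {z : ℂ} (hz : 0 < z) : ∃ r : ℝ, 0 < r ∧ z = r := by
  obtain ⟨h1, h2⟩ := Complex.pos_iff.mp hz
  exact ⟨z.re, h1, Complex.ext rfl (by simpa using h2.symm)⟩

end QuasimodularForm

theorem corollary4p4 (w : ℕ) (hw : Even w) (hw6 : 6 ≤ w) :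
    (∃! X : UpperHalfPlane → ℂ, QuasimodularForm.IsNormalizedExtremal w 1 X) ∧
    ∀ X : UpperHalfPlane → ℂ, QuasimodularForm.IsNormalizedExtremal w 1 X →
      QuasimodularForm.IsCompletelyPositive X ∧
      ∀ n : ℕ, Module.finrank ℂ (QuasimodularForm.QM w 1) - 1 ≤ n →
        ∃ r : ℝ, 0 < r ∧ QuasimodularForm.fourierCoeff X n = (r : ℂ) := by
  obtain ⟨h, rfl⟩ := hw.exists_two_nsmul
  rw [smul_eq_mul] at *
  -- Thus h/3 ≥ 1, which both the positivity statement and the depth argument need.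
  have hh : 3 ≤ h := by omega
  obtain ⟨⟨X₀, hX₀⟩, hq⟩ :=
    QuasimodularForm.exists_leadingForm (h := h) (j := h / 3) (by omega)
  change UpperHalfPlane.qExpansion 1 X₀ = _ at hq
  have hl := QuasimodularForm.hasLeading_leadingForm h (h / 3)
  have hpos := QuasimodularForm.posFrom_leadingForm h (j := h / 3) (by omega)
  rw [← hq] at hl hpos
  have huniq (X) (hX : QuasimodularForm.IsNormalizedExtremal (2 * h) 1 X) : X = X₀ := by
    obtain ⟨hm, hXl⟩ := (QuasimodularForm.isNormalizedExtremal_iff hh).mp hX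
    exact QuasimodularForm.eq_of_hasLeading hm hX₀ hXl hl
  refine ⟨⟨X₀, (QuasimodularForm.isNormalizedExtremal_iff hh).mpr ⟨hX₀, hl⟩, huniq⟩, ?_⟩
  intro X hX
  obtain rfl := huniq X hX
  have hpos' (n : ℕ) (hn : h / 3 ≤ n) :
      ∃ r : ℝ, 0 < r ∧ QuasimodularForm.fourierCoeff X n = (r : ℂ) :=
    QuasimodularForm.exists_real_of_pos (hpos.2 n hn)
  constructor
  · intro n
    rcases lt_or_ge n (h / 3) with hn | hn
    · exact ⟨0, le_rfl, by rw [Complex.ofReal_zero]; exact hpos.1 n hn⟩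
    · obtain ⟨r, hr, he⟩ := hpos' n hn
      exact ⟨r, hr.le, he⟩
  · intro n hn
    rw [(QuasimodularForm.finrank_QM_and_injective h).1] at hn
    exact hpos' n (by omega)
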